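/- Let $z_1,z_2,z_3,z_4\in\mathbb C$ be distinct, let $N\ge 1$ and let $A=(a_{i,j})$ be an $m\times 4$ matrix over $\mathbb Z_N=\mathbb Z/N\mathbb Z$ each of whose rows has sum $0$. Let $M_N(A)$ be the compact Riemann surface (smooth projective complex curve) with function field $\mathbb C(z)[w_1,\dots,w_m]\subset\overline{\mathbb C(z)}$, where $w_i^N=\prod_{j=1}^4 (z-z_j)^{\tilde a_{i,j}}$ and $\tilde a_{i,j}\in[0,N)$ is the integer lift of $a_{i,j}$. It comes with its covering map to $\mathbb{CP}^1$ and with the quadratic differential $q$ obtained by lifting $$q_0=\frac{(dz)^2}{(z-z_1)(z-z_2)(z-z_3)(z-z_4)}.$$ The holonomy (double) cover of $(M_N(A),q)$ is the smallest cover of $M_N(A)$ on which $q$ lifts to the square of an abelian differential: $q$ lifts to such a square on it, and every (possibly branched, connected) cover of $M_N(A)$ on which $q$ lifts to the square of an abelian differential factors through it. If $N$ is even, let $N^+=N$ and let $A^+$ be the matrix over $\mathbb Z_N$ obtained by adding to $A$ a row all of whose entries are $N/2$. If $N$ is odd, let $N^+=2N$ and let $A^+$ be the matrix over $\mathbb Z_{2N}$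 obtained by adding a row all of whose entries are $N$ to the matrix $2A$, whose entries are the classes of $2\tilde a_{i,j}$ in $\mathbb Z_{2N}$. Proposition. The rows of $A^+$ have sum $0$, and the holonomy cover of $M_N(A)$ is $M_{N^+}(A^+)$, compatibly with the covering maps to $\mathbb{CP}^1$ and with the lifts of $q_0$. In particular it is again an abelian square-tiled surface: its covering map to $\mathbb{CP}^1$ is normal with abelian deck group and branched at most over $z_1,\dots,z_4$. The cover $M_{N^+}(A^+)\to M_N(A)$ is an isomorphism if $q$ is already the square of an abelian differential on $M_N(A)$, and has degree two otherwise. -/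

import Mathlib

open scoped KaehlerDifferential TensorProduct

universe u v w

noncomputable section

namespace FlatCover

/-! ### Compact Riemann surfaces

A compact connected Riemann surface, equivalently a smooth projective irreducible curve over `ℂ`,
is presented by its field of meromorphic functions, as a complete abstract nonsingular curve:
its points are the places of the field, and nonconstant holomorphic maps (branched covers) are
the embeddings of function fields over `ℂ`, acting on places by restriction. -/

/-- A compact connected Riemann surface: a finitely generated field extension of `ℂ` of
transcendence degree one, the field of meromorphic functions. -/
structure RiemannSurface where
  /-- the field of meromorphic functions -/
  Fun : Type u
  [field : Field Fun]
  [algebra : Algebra ℂ Fun]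
  essFiniteType : Algebra.EssFiniteType ℂ Fun
  trdeg_eq_one : Algebra.trdeg ℂ Fun = 1

attribute [instance] RiemannSurface.field RiemannSurface.algebra

/-- A point of the surface, given by its local ring: a valuation ring of the function field that
contains the constants and is not the whole field (such a ring is a discrete valuation ring). -/
structure RiemannSurface.Point (X : RiemannSurface.{u}) where
  /-- the ring of germs of meromorphic functions that are holomorphic at the point -/
  ring : ValuationSubring X.Fun
  algebraMap_mem : ∀ c : ℂ, algebraMap ℂ X.Fun c ∈ ring
  ne_top : ring ≠ ⊤

/-- `f` is holomorphic at the point `P`. -/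
def RiemannSurface.Point.Holomorphic {X : RiemannSurface.{u}} (P : X.Point) (f : X.Fun) : Prop :=
  f ∈ P.ring

/-- `f` is holomorphic at the point `P` and takes the value zero there. -/
def RiemannSurface.Point.Vanishes {X : RiemannSurface.{u}} (P : X.Point) (f : X.Fun) : Prop :=
  P.ring.valuation f < 1

/-- `t` is a local parameter at `P`: it vanishes at `P`, and every function that vanishes at `P` is
the product of `t` and a function that is holomorphic at `P`. -/
def RiemannSurface.Point.IsLocalParameter {X : RiemannSurface.{u}} (P : X.Point) (t : X.Fun) :
    Prop :=
  P.Vanishes t ∧ ∀ f, P.Vanishes f → ∃ g, P.Holomorphic g ∧ f = g * t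

/-- A (possibly branched) cover `Y → X` of compact Riemann surfaces, i.e. a nonconstant holomorphic
map, given by the pullback of meromorphic functions. -/
structure Cover (Y : RiemannSurface.{v}) (X : RiemannSurface.{u}) where
  /-- the pullback of meromorphic functions -/
  pullback : X.Fun →ₐ[ℂ] Y.Fun

namespace Cover

variable {X : RiemannSurface.{u}} {Y : RiemannSurface.{v}} {Z : RiemannSurface.{w}}

/-- The composite `Z → Y → X`. -/
def comp (p : Cover Y X) (s : Cover Z Y) : Cover Z X := ⟨s.pullback.comp p.pullback⟩

/-- The function field of `Y` as an extension of the function field of `X`. -/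
abbrev toAlgebra (p : Cover Y X) : Algebra X.Fun Y.Fun := p.pullback.toRingHom.toAlgebra

theorem isAlgebraic (p : Cover Y X) :
    letI := p.toAlgebra
    Algebra.IsAlgebraic X.Fun Y.Fun := by
  let := p.toAlgebra
  have : IsScalarTower ℂ X.Fun Y.Fun :=
    IsScalarTower.of_algebraMap_eq fun c => (p.pullback.commutes c).symm
  have h := lift_trdeg_add_eq ℂ X.Fun Y.Fun
  rw [X.trdeg_eq_one, Y.trdeg_eq_one, Cardinal.lift_one, Cardinal.lift_one] at h
  have h0 : Algebra.trdeg X.Fun Y.Fun = 0 := by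
    have h' : (1 : Cardinal) + Cardinal.lift.{u} (Algebra.trdeg X.Fun Y.Fun) = 1 + 0 := by
      rw [h, add_zero]
    have := Cardinal.eq_of_add_eq_add_left h' Cardinal.one_lt_aleph0
    exact Cardinal.lift_eq_zero.1 this
  exact trdeg_eq_zero_iff.1 h0

/-- The map on points: `f` is holomorphic at the image of `P` if and only if the pullback of `f` is
holomorphic at `P`. -/
def onPoints (p : Cover Y X) (P : Y.Point) : X.Point where
  ring := P.ring.comap p.pullback.toRingHom
  algebraMap_mem c := by
    change p.pullback (algebraMap ℂ X.Fun c) ∈ P.ring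
    rw [p.pullback.commutes]
    exact P.algebraMap_mem c
  ne_top h := by
    refine P.ne_top (SetLike.ext fun y => ⟨fun _ => trivial, fun _ => ?_⟩)
    let := p.toAlgebra
    have := p.isAlgebraic
    have hy : IsIntegral X.Fun y := (Algebra.IsAlgebraic.isAlgebraic (R := X.Fun) y).isIntegral
    have hmem : ∀ x : X.Fun, p.pullback x ∈ P.ring := fun x => by
      have : x ∈ P.ring.comap p.pullback.toRingHom := by rw [h]; trivial
      exact this
    have hy' : IsIntegral P.ring y := by
      obtain ⟨f, hf, hfy⟩ := hy
      refine ⟨f.map (p.pullback.toRingHom.codRestrict P.ring.toSubring hmem), hf.map _, ?_⟩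
      rw [Polynomial.eval₂_map]
      exact hfy
    obtain ⟨a, ha⟩ := IsIntegrallyClosed.isIntegral_iff.1 hy'
    rw [← ha]
    exact a.2

/-- The number of sheets. -/
def degree (p : Cover Y X) : ℕ :=
  letI := p.toAlgebra
  Module.finrank X.Fun Y.Fun

/-- The cover is unramified at `P`: the pullback of a local parameter at the image of `P` is a local
parameter at `P`. -/
def UnramifiedAt (p : Cover Y X) (P : Y.Point) : Prop :=
  ∃ t : X.Fun, (p.onPoints P).IsLocalParameter t ∧ P.IsLocalParameter (p.pullback t)

/-- The cover is normal (Galois) and its deck group is abelian. -/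
def IsNormalAbelian (p : Cover Y X) : Prop :=
  letI := p.toAlgebra
  IsAbelianGalois X.Fun Y.Fun

end Cover

/-! ### Differentials -/

/-- Meromorphic one-forms. -/
abbrev RiemannSurface.OneForm (X : RiemannSurface.{u}) : Type u := Ω[X.Fun⁄ℂ]

/-- The meromorphic one-form `df`. -/
abbrev RiemannSurface.d {X : RiemannSurface.{u}} (f : X.Fun) : X.OneForm :=
  KaehlerDifferential.D ℂ X.Fun f

/-- Meromorphic quadratic differentials. As the one-forms are one-dimensional over the function
field, the tensor square is the symmetric square. -/
abbrev RiemannSurface.QuadDiff (X : RiemannSurface.{u}) : Type u := X.OneForm ⊗[X.Fun] X.OneForm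

/-- An abelian differential: at every point it is a combination `∑ fᵢ dgᵢ` with `fᵢ` and `gᵢ`
holomorphic at the point. -/
def RiemannSurface.IsAbelianDifferential {X : RiemannSurface.{u}} (ω : X.OneForm) : Prop :=
  ∀ P : X.Point, ω ∈ Submodule.span P.ring {η : X.OneForm | ∃ f, P.Holomorphic f ∧ η = X.d f}

/-- `q` is the square of an abelian differential. -/
def RiemannSurface.IsSquareOfAbelian {X : RiemannSurface.{u}} (q : X.QuadDiff) : Prop :=
  ∃ ω : X.OneForm, X.IsAbelianDifferential ω ∧ q = ω ⊗ₜ[X.Fun] ω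

namespace Cover

variable {X : RiemannSurface.{u}} {Y : RiemannSurface.{v}}

/-- The pullback of one-forms. -/
def pullbackForm (p : Cover Y X) : X.OneForm →+ Y.OneForm :=
  letI := p.toAlgebra
  haveI : IsScalarTower ℂ X.Fun Y.Fun :=
    IsScalarTower.of_algebraMap_eq fun c => (p.pullback.commutes c).symm
  (KaehlerDifferential.map ℂ ℂ X.Fun Y.Fun).toAddMonoidHom

theorem pullbackForm_smul (p : Cover Y X) (f : X.Fun) (ω : X.OneForm) :
    p.pullbackForm (f • ω) = p.pullback f • p.pullbackForm ω := by
  let := p.toAlgebra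
  have : IsScalarTower ℂ X.Fun Y.Fun :=
    IsScalarTower.of_algebraMap_eq fun c => (p.pullback.commutes c).symm
  have h := (KaehlerDifferential.map ℂ ℂ X.Fun Y.Fun).map_smul f ω
  rw [← algebraMap_smul Y.Fun f (KaehlerDifferential.map ℂ ℂ X.Fun Y.Fun ω)] at h
  exact h

theorem pullbackForm_d (p : Cover Y X) (f : X.Fun) :
    p.pullbackForm (X.d f) = Y.d (p.pullback f) := by
  let := p.toAlgebra
  have : IsScalarTower ℂ X.Fun Y.Fun :=
    IsScalarTower.of_algebraMap_eq fun c => (p.pullback.commutes c).symm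
  exact KaehlerDifferential.map_D ℂ ℂ X.Fun Y.Fun f

/-- The pullback (lift) of quadratic differentials, with `p^*(ω ⊗ η) = p^*ω ⊗ p^*η`. -/
def pullbackQuad (p : Cover Y X) : X.QuadDiff →+ Y.QuadDiff :=
  TensorProduct.liftAddHom
    (((AddMonoidHom.mk' (fun a : Y.OneForm => (TensorProduct.mk Y.Fun _ Y.OneForm a).toAddMonoidHom)
      (fun a b => by ext; simp)).comp p.pullbackForm).compl₂ p.pullbackForm)
    (fun f a b => by
      change p.pullbackForm (f • a) ⊗ₜ[Y.Fun] p.pullbackForm b =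
        p.pullbackForm a ⊗ₜ[Y.Fun] p.pullbackForm (f • b)
      rw [pullbackForm_smul, pullbackForm_smul, TensorProduct.smul_tmul])

theorem pullbackQuad_tmul (p : Cover Y X) (a b : X.OneForm) :
    p.pullbackQuad (a ⊗ₜ[X.Fun] b) = p.pullbackForm a ⊗ₜ[Y.Fun] p.pullbackForm b := rfl

/-- `p : Y → X` is the holonomy cover of `(X, q)`: the smallest cover of `X` on which `q` lifts to
the square of an abelian differential. That is, `q` lifts to such a square on `Y`, and every cover
of `X` with this property factors through `p`. -/
def IsHolonomyCover {X Y : RiemannSurface.{u}} (p : Cover Y X) (q : X.QuadDiff) : Prop :=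
  Y.IsSquareOfAbelian (p.pullbackQuad q) ∧
    ∀ (Z : RiemannSurface.{u}) (r : Cover Z X), Z.IsSquareOfAbelian (r.pullbackQuad q) →
      ∃ s : Cover Z Y, p.comp s = r

end Cover

/-! ### The pillowcase and its abelian covers -/

theorem trdeg_ratFunc : Algebra.trdeg ℂ (RatFunc ℂ) = 1 := by
  have h := trdeg_add_eq ℂ (Polynomial ℂ) (A := RatFunc ℂ)
  have : Algebra.IsAlgebraic (Polynomial ℂ) (RatFunc ℂ) :=
    IsLocalization.isAlgebraic _ (nonZeroDivisors (Polynomial ℂ))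
  rw [Polynomial.trdeg_of_isDomain, trdeg_eq_zero, add_zero] at h
  exact h.symm

theorem essFiniteType_ratFunc : Algebra.EssFiniteType ℂ (RatFunc ℂ) := by
  have : Algebra.EssFiniteType (Polynomial ℂ) (RatFunc ℂ) :=
    Algebra.EssFiniteType.of_isLocalization _ (nonZeroDivisors (Polynomial ℂ))
  exact Algebra.EssFiniteType.comp ℂ (Polynomial ℂ) (RatFunc ℂ)

/-- The Riemann sphere, with function field `ℂ(z)`. -/
def sphere : RiemannSurface.{0} where
  Fun := RatFunc ℂ
  essFiniteType := essFiniteType_ratFunc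
  trdeg_eq_one := trdeg_ratFunc

/-- The coordinate function on the sphere. -/
def coord : sphere.Fun := (RatFunc.X : RatFunc ℂ)

/-- The pillowcase quadratic differential `(dz)² / ((z - z₁)(z - z₂)(z - z₃)(z - z₄))`. -/
def pillowcase (z : Fin 4 → ℂ) : sphere.QuadDiff :=
  (∏ j, (coord - algebraMap ℂ sphere.Fun (z j)))⁻¹ •
    (sphere.d coord ⊗ₜ[sphere.Fun] sphere.d coord)

/-- A cover of the sphere is abelian square-tiled (with respect to `z₁, …, z₄`) if it is normal with
abelian deck group and branched at most over `z₁, …, z₄`. Its flat structure is the lift of the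
pillowcase differential. -/
def IsAbelianSquareTiled {X : RiemannSurface.{u}} (z : Fin 4 → ℂ) (p : Cover X sphere) : Prop :=
  p.IsNormalAbelian ∧
    ∀ P : X.Point,
      (∀ j, ¬ (p.onPoints P).Vanishes (coord - algebraMap ℂ sphere.Fun (z j))) → p.UnramifiedAt P

/-- A choice of functions `w₁, …, wₘ` in the algebraic closure of `ℂ(z)` with
`wᵢ ^ N = ∏ⱼ (z - zⱼ) ^ ãᵢⱼ`, where `ãᵢⱼ` is the lift of `aᵢⱼ` to `[0, N)`. -/
structure RootChoice (z : Fin 4 → ℂ) {N m : ℕ} (A : Matrix (Fin m) (Fin 4) (ZMod N)) where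
  /-- the chosen functions -/
  w : Fin m → AlgebraicClosure (RatFunc ℂ)
  w_pow : ∀ i, w i ^ N =
    algebraMap (RatFunc ℂ) (AlgebraicClosure (RatFunc ℂ))
      (∏ j, (RatFunc.X - RatFunc.C (z j)) ^ (A i j).val)

section

variable {z : Fin 4 → ℂ} {N m : ℕ} {A : Matrix (Fin m) (Fin 4) (ZMod N)}

/-- The field `ℂ(z)[w₁, …, wₘ]`. -/
abbrev funField (W : RootChoice z A) :
    IntermediateField (RatFunc ℂ) (AlgebraicClosure (RatFunc ℂ)) :=
  IntermediateField.adjoin (RatFunc ℂ) (Set.range W.w)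

theorem finiteDimensional_funField (W : RootChoice z A) :
    FiniteDimensional (RatFunc ℂ) (funField W) :=
  IntermediateField.finiteDimensional_adjoin fun x _ =>
    (Algebra.IsAlgebraic.isAlgebraic (R := RatFunc ℂ) x).isIntegral

/-- The surface `M_N(A)`, with function field `ℂ(z)[w₁, …, wₘ]`. -/
def abelianCover (W : RootChoice z A) : RiemannSurface.{0} where
  Fun := funField W
  essFiniteType := by
    have := finiteDimensional_funField W
    have := essFiniteType_ratFunc
    have : Algebra.EssFiniteType (RatFunc ℂ) (funField W) := inferInstance
    exact Algebra.EssFiniteType.comp ℂ (RatFunc ℂ) (funField W)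
  trdeg_eq_one := by
    have := finiteDimensional_funField W
    have h := trdeg_add_eq ℂ (RatFunc ℂ) (A := funField W)
    rw [trdeg_ratFunc, trdeg_eq_zero, add_zero] at h
    exact h.symm

/-- The covering map `M_N(A) → ℂP¹`. -/
def covering (W : RootChoice z A) : Cover (abelianCover W) sphere where
  pullback := (IsScalarTower.toAlgHom ℂ (RatFunc ℂ) (funField W) :)

/-- The quadratic differential of `M_N(A)`: the lift of the pillowcase differential. -/
def flatStructure (W : RootChoice z A) : (abelianCover W).QuadDiff :=
  (covering W).pullbackQuad (pillowcase z)

end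

/-- The standing requirement on a matrix used to present an abelian cover: every row has sum zero,
so that the cover is not branched over infinity. -/
def RowSumsZero {N m : ℕ} (A : Matrix (Fin m) (Fin 4) (ZMod N)) : Prop :=
  ∀ i, ∑ j, A i j = 0

/-- The matrix `A` with one more row, all of whose entries are `r`. -/
def addConstRow {N m : ℕ} (A : Matrix (Fin m) (Fin 4) (ZMod N)) (r : ZMod N) :
    Matrix (Fin (m + 1)) (Fin 4) (ZMod N) :=
  Matrix.of fun i j => (Fin.snoc (fun k => A k j) r : Fin (m + 1) → ZMod N) i

/-- The matrix `2A` over `ℤ/2N`, for a matrix `A` over `ℤ/N`. -/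
def double {N m : ℕ} (A : Matrix (Fin m) (Fin 4) (ZMod N)) :
    Matrix (Fin m) (Fin 4) (ZMod (2 * N)) :=
  Matrix.of fun i j => ((2 * (A i j).val : ℕ) : ZMod (2 * N))

/-- `M_{N'}(A')` is the holonomy cover of `M_N(A)`, compatibly with the covering maps to the sphere
and with the flat structures, and it is again an abelian square-tiled surface. The covering map is
an isomorphism if `q` is already the square of an abelian differential, and is two-sheeted
otherwise. -/
def HolonomyCoverIs (z : Fin 4 → ℂ) {N N' m m' : ℕ} (A : Matrix (Fin m) (Fin 4) (ZMod N))
    (A' : Matrix (Fin m') (Fin 4) (ZMod N')) : Prop :=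
  RowSumsZero A' ∧
    ∀ (W : RootChoice z A) (W' : RootChoice z A'),
      IsAbelianSquareTiled z (covering W') ∧
        ∃ p : Cover (abelianCover W') (abelianCover W),
          (covering W).comp p = covering W' ∧
            p.pullbackQuad (flatStructure W) = flatStructure W' ∧
              p.IsHolonomyCover (flatStructure W) ∧
                ((abelianCover W).IsSquareOfAbelian (flatStructure W) → p.degree = 1) ∧
                  (¬ (abelianCover W).IsSquareOfAbelian (flatStructure W) → p.degree = 2)

end FlatCover

end

noncomputable section

namespace FlatCover

/-! ### One-forms and quadratic differentials in terms of `dz` -/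

/-! On any cover of the sphere the one-forms are a line spanned by `dz`, so the lift of `q_0` is
`Q⁻¹ dz ⊗ dz` with `Q = ∏ (z - z_j)`, and it equals `ω ⊗ ω` for `ω = f dz` exactly when `f² = Q⁻¹`.
Conversely, if `u² = Q`, then `dz / u` has no poles, because the roots of `Q` are simple and its
degree is four. Hence being the square of an abelian differential means that `Q` has a square root
(`Cover.isSquareOfAbelian_iff`), and the holonomy cover is obtained by adjoining `√Q`. Its
minimality (`Cover.exists_comp_eq_of_sq`) and its degree are Galois theory of `X² - Q`.

The constant row adjoins `w` with `w ^ (2M) = Q ^ M`. Then `w²` and `Q` differ by a constant, which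
has a square root in `ℂ`, so adjoining `w` is adjoining `√Q`. The other rows of `A⁺` give the old
`w_i` up to constants (`holonomyCoverIs_of_val`).

The deck group is abelian because each automorphism scales every `w_i` by a constant. For the
branching, the `w_i` are approximated at `P` by functions on the sphere, by Newton iteration
(`IsUniformizer.isLimit_of_pow_eq`). Every function on the cover is then such a limit, so no new
values arise at `P` (`IsUniformizer.unramifiedAt`). -/

/-- The one-forms of an algebraic extension of `ℂ(z)` are freely generated by `dz`. -/
theorem exists_kaehlerEquiv (F : Type u) [Field F] [Algebra ℂ F] [Algebra (RatFunc ℂ) F]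
    [IsScalarTower ℂ (RatFunc ℂ) F] [Algebra.IsAlgebraic (RatFunc ℂ) F] :
    ∃ e : Ω[F⁄ℂ] ≃ₗ[F] F,
      e (KaehlerDifferential.D ℂ F (algebraMap (RatFunc ℂ) F RatFunc.X)) = 1 := by
  let : Algebra (Polynomial ℂ) F :=
    ((algebraMap (RatFunc ℂ) F).comp (algebraMap (Polynomial ℂ) (RatFunc ℂ))).toAlgebra
  have : IsScalarTower (Polynomial ℂ) (RatFunc ℂ) F := IsScalarTower.of_algebraMap_eq fun _ => rfl
  have : IsScalarTower ℂ (Polynomial ℂ) F := IsScalarTower.of_algebraMap_eq fun c => by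
    rw [IsScalarTower.algebraMap_apply (Polynomial ℂ) (RatFunc ℂ) F,
      ← IsScalarTower.algebraMap_apply ℂ (Polynomial ℂ) (RatFunc ℂ),
      ← IsScalarTower.algebraMap_apply ℂ (RatFunc ℂ) F]
  -- A localization followed by a separable algebraic extension is formally étale, and differentials
  -- base change along such maps. This reduces the claim to `ℂ[X]`.
  have : Algebra.FormallyEtale (RatFunc ℂ) F := Algebra.FormallyEtale.of_isSeparable _ _
  have : Algebra.FormallyEtale (Polynomial ℂ) (RatFunc ℂ) :=
    Algebra.FormallyEtale.of_isLocalization (nonZeroDivisors (Polynomial ℂ))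
  have : Algebra.FormallyEtale (Polynomial ℂ) F := Algebra.FormallyEtale.comp _ (RatFunc ℂ) F
  let e₁ := (KaehlerDifferential.tensorKaehlerEquivOfFormallyEtale ℂ (Polynomial ℂ) F).symm
  let e₂ := TensorProduct.AlgebraTensorModule.congr (LinearEquiv.refl F F)
    (KaehlerDifferential.polynomialEquiv ℂ)
  let e₃ := TensorProduct.AlgebraTensorModule.rid (Polynomial ℂ) F F
  refine ⟨e₁ ≪≫ₗ e₂ ≪≫ₗ e₃, ?_⟩
  have h : algebraMap (RatFunc ℂ) F RatFunc.X = algebraMap (Polynomial ℂ) F Polynomial.X := by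
    rw [IsScalarTower.algebraMap_apply (Polynomial ℂ) (RatFunc ℂ) F, RatFunc.algebraMap_X]
  rw [h]
  simp [e₁, e₂, e₃, KaehlerDifferential.tensorKaehlerEquivOfFormallyEtale_symm_D_algebraMap,
    KaehlerDifferential.polynomialEquiv_D]

namespace Cover

variable {X : RiemannSurface.{u}} {Y : RiemannSurface.{v}} {Z : RiemannSurface.{w}}

/-- The pullback of the coordinate function. -/
def z (p : Cover Y sphere) : Y.Fun := p.pullback coord

/-- The pullback of `(z - z₁)(z - z₂)(z - z₃)(z - z₄)`. -/
def quartic (a : Fin 4 → ℂ) (p : Cover Y sphere) : Y.Fun :=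
  ∏ j, (p.z - algebraMap ℂ Y.Fun (a j))

theorem z_comp (p : Cover Y sphere) (s : Cover Z Y) : (p.comp s).z = s.pullback p.z := rfl

theorem quartic_comp (a : Fin 4 → ℂ) (p : Cover Y sphere) (s : Cover Z Y) :
    (p.comp s).quartic a = s.pullback (p.quartic a) := by
  simp [quartic, z_comp]

theorem exists_formEquiv (p : Cover Y sphere) :
    ∃ e : Y.OneForm ≃ₗ[Y.Fun] Y.Fun, e (Y.d p.z) = 1 := by
  let : Algebra (RatFunc ℂ) Y.Fun := p.toAlgebra
  have : IsScalarTower ℂ (RatFunc ℂ) Y.Fun :=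
    IsScalarTower.of_algebraMap_eq fun c => (p.pullback.commutes c).symm
  have : Algebra.IsAlgebraic (RatFunc ℂ) Y.Fun := p.isAlgebraic
  exact exists_kaehlerEquiv Y.Fun

theorem exists_eq_smul_d_z (p : Cover Y sphere) (ω : Y.OneForm) : ∃ f : Y.Fun, ω = f • Y.d p.z := by
  obtain ⟨e, he⟩ := p.exists_formEquiv
  exact ⟨e ω, e.injective (by rw [map_smul, he, smul_eq_mul, mul_one])⟩

theorem smul_d_z_tmul_injective (p : Cover Y sphere) {f g : Y.Fun}
    (h : f • (Y.d p.z ⊗ₜ[Y.Fun] Y.d p.z) = g • (Y.d p.z ⊗ₜ[Y.Fun] Y.d p.z)) : f = g := by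
  obtain ⟨e, he⟩ := p.exists_formEquiv
  have := congrArg (TensorProduct.congr e e ≪≫ₗ TensorProduct.lid Y.Fun Y.Fun) h
  simpa [he] using this

theorem pullbackQuad_smul_d (p : Cover Y X) (f g : X.Fun) :
    p.pullbackQuad (f • (X.d g ⊗ₜ[X.Fun] X.d g)) =
      p.pullback f • (Y.d (p.pullback g) ⊗ₜ[Y.Fun] Y.d (p.pullback g)) := by
  rw [TensorProduct.smul_tmul', pullbackQuad_tmul, pullbackForm_smul, pullbackForm_d,
    TensorProduct.smul_tmul']

theorem pullbackQuad_pillowcase (a : Fin 4 → ℂ) (p : Cover Y sphere) :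
    p.pullbackQuad (pillowcase a) = (p.quartic a)⁻¹ • (Y.d p.z ⊗ₜ[Y.Fun] Y.d p.z) := by
  rw [pillowcase, pullbackQuad_smul_d]
  simp [quartic, z]

theorem pullbackQuad_comp_pillowcase (a : Fin 4 → ℂ) (p : Cover Y sphere) (s : Cover Z Y) :
    s.pullbackQuad (p.pullbackQuad (pillowcase a)) = (p.comp s).pullbackQuad (pillowcase a) := by
  rw [pullbackQuad_pillowcase, pullbackQuad_smul_d, pullbackQuad_pillowcase, quartic_comp, z_comp,
    map_inv₀]

theorem transcendental_z (p : Cover Y sphere) : Transcendental ℂ p.z := by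
  have h : Transcendental ℂ (RatFunc.X : RatFunc ℂ) := RatFunc.transcendental_X
  exact fun h' => h ((isAlgebraic_algHom_iff p.pullback p.pullback.injective).1 h')

theorem z_sub_ne_zero (p : Cover Y sphere) (c : ℂ) : p.z - algebraMap ℂ Y.Fun c ≠ 0 := fun h =>
  p.transcendental_z (by rw [sub_eq_zero.1 h]; exact isAlgebraic_algebraMap c)

theorem quartic_ne_zero (a : Fin 4 → ℂ) (p : Cover Y sphere) : p.quartic a ≠ 0 :=
  Finset.prod_ne_zero_iff.2 fun j _ => p.z_sub_ne_zero (a j)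

end Cover

/-! ### Valuations at a point -/

namespace RiemannSurface.Point

variable {X : RiemannSurface.{u}} (P : X.Point)

theorem vanishes_iff {f : X.Fun} : P.Vanishes f ↔ f = 0 ∨ f⁻¹ ∉ P.ring :=
  P.ring.mem_nonunits_iff_or

theorem valuation_algebraMap_le_one (c : ℂ) : P.ring.valuation (algebraMap ℂ X.Fun c) ≤ 1 :=
  (P.ring.valuation_le_one_iff _).2 (P.algebraMap_mem c)

theorem valuation_algebraMap {c : ℂ} (hc : c ≠ 0) : P.ring.valuation (algebraMap ℂ X.Fun c) = 1 := by
  refine le_antisymm (P.valuation_algebraMap_le_one c) ?_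
  have h := P.valuation_algebraMap_le_one c⁻¹
  rw [map_inv₀, map_inv₀] at h
  have h0 : 0 < P.ring.valuation (algebraMap ℂ X.Fun c) := by
    simpa [zero_lt_iff] using hc
  exact (inv_le_one₀ h0).1 h

theorem aeval_mem {f : X.Fun} (hf : f ∈ P.ring) (p : Polynomial ℂ) :
    Polynomial.aeval f p ∈ P.ring := by
  induction p using Polynomial.induction_on' with
  | add p q hp hq => rw [map_add]; exact add_mem hp hq
  | monomial n c =>
    rw [Polynomial.aeval_monomial]
    exact mul_mem (P.algebraMap_mem c) (pow_mem hf n)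

theorem valuation_eq_one_of_pow {f : X.Fun} {n : ℕ} (hn : n ≠ 0)
    (h : P.ring.valuation (f ^ n) = 1) : P.ring.valuation f = 1 := by
  rw [map_pow] at h
  exact (pow_eq_one_iff_of_nonneg zero_le hn).1 h

theorem smul_d_mem {f g : X.Fun} (hf : f ∈ P.ring) (hg : g ∈ P.ring) :
    f • X.d g ∈ Submodule.span P.ring {η : X.OneForm | ∃ f, P.Holomorphic f ∧ η = X.d f} :=
  Submodule.smul_mem _ (⟨f, hf⟩ : P.ring) (Submodule.subset_span ⟨g, hg, rfl⟩)

end RiemannSurface.Point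

/-! ### Lifts of the pillowcase differential that are squares -/

namespace Cover

variable {Y : RiemannSurface.{u}} (a : Fin 4 → ℂ) (p : Cover Y sphere)

/-- The polynomial `(X - z₁)(X - z₂)(X - z₃)(X - z₄)`. -/
def quarticPoly : Polynomial ℂ := ∏ j, (Polynomial.X - Polynomial.C (a j))

theorem aeval_quarticPoly : Polynomial.aeval p.z (quarticPoly a) = p.quartic a := by
  simp [quarticPoly, quartic]

/-- Differentiating `u² = Q(z)` allows `dz` to be traded for `du` at the zeros of `Q`. -/
theorem two_mul_smul_d_sqrt {u : Y.Fun} (hu : u ^ 2 = p.quartic a) :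
    (2 * u) • Y.d u = Polynomial.aeval p.z (Polynomial.derivative (quarticPoly a)) • Y.d p.z := by
  have h := congrArg Y.d (hu.trans (aeval_quarticPoly a p).symm)
  rw [RiemannSurface.d, RiemannSurface.d, Derivation.map_aeval, Derivation.leibniz_pow] at h
  rw [RiemannSurface.d, RiemannSurface.d, ← h, mul_smul, pow_one, ← Nat.cast_smul_eq_nsmul Y.Fun, Nat.cast_ofNat]

variable {a}

theorem isAbelianDifferential_inv_sqrt (ha : Function.Injective a) {u : Y.Fun}
    (hu : u ^ 2 = p.quartic a) : Y.IsAbelianDifferential (u⁻¹ • Y.d p.z) := by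
  intro P
  have hu0 : u ≠ 0 := fun h => p.quartic_ne_zero a (by rw [← hu, h]; simp)
  by_cases hz : p.z ∈ P.ring
  · have hmem := P.aeval_mem hz
    have hQ : P.ring.valuation (p.quartic a) ≤ 1 := by
      rw [P.ring.valuation_le_one_iff, ← aeval_quarticPoly]
      exact hmem _
    rcases hQ.lt_or_eq with hQ | hQ
    -- At a zero of `Q`, the Bézout relation `A Q + B Q' = 1` makes `Q'(z)` a unit, so `dz / u = 2
    -- du / Q'(z)` is holomorphic.
    · have hsep : (quarticPoly a).Separable := Polynomial.separable_prod_X_sub_C_iff.2 ha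
      rw [Polynomial.separable_def'] at hsep
      obtain ⟨A, B, hAB⟩ := hsep
      set D := Polynomial.aeval p.z (Polynomial.derivative (quarticPoly a)) with hD
      have h1 : Polynomial.aeval p.z B * D = 1 - Polynomial.aeval p.z A * p.quartic a := by
        have := congrArg (Polynomial.aeval p.z) hAB
        rw [map_add, map_mul, map_mul, aeval_quarticPoly, map_one] at this
        rw [← this, hD]
        ring
      have h2 : P.ring.valuation (Polynomial.aeval p.z A * p.quartic a) < 1 := by
        rw [map_mul]
        exact (mul_le_of_le_one_left' ((P.ring.valuation_le_one_iff _).2 (hmem A))).trans_lt hQ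
      have h3 : P.ring.valuation (Polynomial.aeval p.z B) * P.ring.valuation D = 1 := by
        rw [← map_mul, h1, Valuation.map_one_sub_of_lt _ h2]
      have hD0 : D ≠ 0 := fun h => by simp [h] at h3
      have h4 : D⁻¹ ∈ P.ring := by
        rw [← P.ring.valuation_le_one_iff, map_inv₀, ← eq_inv_of_mul_eq_one_left h3]
        exact (P.ring.valuation_le_one_iff _).2 (hmem B)
      have h5 : u⁻¹ • Y.d p.z = (2 * D⁻¹) • Y.d u := by
        have h := two_mul_smul_d_sqrt a p hu
        calc u⁻¹ • Y.d p.z = (u⁻¹ * D⁻¹) • (D • Y.d p.z) := by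
              rw [smul_smul, mul_assoc, inv_mul_cancel₀ hD0, mul_one]
          _ = (2 * D⁻¹) • Y.d u := by
              rw [← h, smul_smul]
              congr 1
              field_simp
      rw [h5]
      refine P.smul_d_mem (mul_mem ?_ h4) ?_
      · exact ofNat_mem P.ring 2
      · rw [← P.ring.valuation_le_one_iff]
        rw [← hu, map_pow] at hQ
        exact (pow_le_one_iff two_ne_zero).1 hQ.le
    · refine P.smul_d_mem ?_ hz
      rw [← hu] at hQ
      rw [← P.ring.valuation_le_one_iff, map_inv₀, P.valuation_eq_one_of_pow two_ne_zero hQ, inv_one]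
  -- At a pole of `z`, use `dz = -z² d(z⁻¹)`. The coefficient `z² / u` is a unit since its square is
  -- the inverse of `∏ (1 - z_j / z)`; four factors are exactly what `z⁴` absorbs.
  · have hz0 : p.z ≠ 0 := fun h => hz (h ▸ zero_mem _)
    have hz' : p.z⁻¹ ∈ P.ring := (P.ring.mem_or_inv_mem _).resolve_left hz
    have hv : P.ring.valuation p.z⁻¹ < 1 := by
      refine P.vanishes_iff.2 (Or.inr ?_)
      rwa [inv_inv]
    have h1 : u⁻¹ • Y.d p.z = (-(p.z ^ 2 * u⁻¹)) • Y.d p.z⁻¹ := by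
      rw [RiemannSurface.d, RiemannSurface.d, Derivation.leibniz_inv, smul_smul]
      congr 1
      field_simp
    rw [h1]
    refine P.smul_d_mem (neg_mem ?_) hz'
    rw [← P.ring.valuation_le_one_iff]
    refine (P.valuation_eq_one_of_pow two_ne_zero ?_).le
    have h2 : (p.z ^ 2 * u⁻¹) ^ 2 = (∏ j, (1 - algebraMap ℂ Y.Fun (a j) * p.z⁻¹))⁻¹ := by
      rw [mul_pow, inv_pow, hu]
      refine eq_inv_of_mul_eq_one_left ?_
      rw [mul_right_comm, mul_inv_eq_one₀]
      · simp only [quartic, Fin.prod_univ_four]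
        field_simp
      · exact p.quartic_ne_zero a
    rw [h2, map_inv₀, map_prod, Finset.prod_eq_one, inv_one]
    intro j _
    refine Valuation.map_one_sub_of_lt _ ?_
    rw [map_mul]
    exact (mul_le_of_le_one_left' (P.valuation_algebraMap_le_one _)).trans_lt hv

/-- The lift of the pillowcase differential is the square of an abelian differential if and only if
`(z - z₁)(z - z₂)(z - z₃)(z - z₄)` has a square root. -/
theorem isSquareOfAbelian_iff (ha : Function.Injective a) :
    Y.IsSquareOfAbelian (p.pullbackQuad (pillowcase a)) ↔ ∃ u : Y.Fun, u ^ 2 = p.quartic a := by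
  rw [pullbackQuad_pillowcase]
  constructor
  · rintro ⟨ω, -, hω⟩
    obtain ⟨f, rfl⟩ := p.exists_eq_smul_d_z ω
    rw [TensorProduct.smul_tmul_smul] at hω
    refine ⟨f⁻¹, ?_⟩
    rw [inv_pow, sq, ← p.smul_d_z_tmul_injective hω, inv_inv]
  · rintro ⟨u, hu⟩
    refine ⟨_, p.isAbelianDifferential_inv_sqrt ha hu, ?_⟩
    rw [TensorProduct.smul_tmul_smul, ← hu, sq, mul_inv]

end Cover

/-! ### Unramified points -/

namespace RiemannSurface.Point

variable {X : RiemannSurface.{u}} (P : X.Point)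

theorem valuation_le_of_eq_zpow {f t : X.Fun} (ht0 : t ≠ 0) (ht : P.Vanishes t)
    (hf : P.Vanishes f) {n : ℤ} (h : P.ring.valuation f = P.ring.valuation t ^ n) :
    P.ring.valuation f ≤ P.ring.valuation t := by
  have h0 : 0 < P.ring.valuation t := by simpa [zero_lt_iff] using ht0
  have hn : 1 ≤ n := by
    by_contra! hn
    exact absurd (h ▸ one_le_zpow_of_nonpos₀ h0 ht.le (by omega : n ≤ 0)) (not_le.2 hf)
  rw [h]
  simpa using zpow_le_zpow_right_of_le_one₀ h0 ht.le hn

theorem div_mem_of_valuation_le {f t : X.Fun}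
    (h : P.ring.valuation f ≤ P.ring.valuation t) : f / t ∈ P.ring := by
  rw [← P.ring.valuation_le_one_iff, map_div₀]
  exact div_le_one_of_le₀ h zero_le

theorem isLocalParameter_of_forall_eq_zpow {t : X.Fun} (ht0 : t ≠ 0) (ht : P.Vanishes t)
    (h : ∀ f : X.Fun, f ≠ 0 → ∃ n : ℤ, P.ring.valuation f = P.ring.valuation t ^ n) :
    P.IsLocalParameter t := by
  refine ⟨ht, fun f hf => ⟨f / t, ?_, (div_mul_cancel₀ f ht0).symm⟩⟩
  by_cases hf0 : f = 0
  · rw [hf0, zero_div]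
    exact zero_mem _
  obtain ⟨n, hn⟩ := h f hf0
  exact P.div_mem_of_valuation_le (P.valuation_le_of_eq_zpow ht0 ht hf hn)

/-- Second-order Taylor expansion with a remainder holomorphic at `P`, the input for Newton
iteration. -/
theorem exists_add_pow_eq {x e : X.Fun} (hx : x ∈ P.ring) (he : e ∈ P.ring) (n : ℕ) :
    ∃ k ∈ P.ring, (x + e) ^ n = x ^ n + n * x ^ (n - 1) * e + k * e ^ 2 := by
  obtain ⟨k, hk⟩ := Polynomial.powAddExpansion (⟨x, hx⟩ : P.ring) ⟨e, he⟩ n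
  refine ⟨k, k.2, ?_⟩
  have h := congrArg (algebraMap P.ring X.Fun) hk
  simp only [map_add, map_mul, map_pow, map_natCast] at h
  exact h

theorem valuation_natCast_mul_pow {x : X.Fun} (hx : P.ring.valuation x = 1) {n : ℕ} (hn : n ≠ 0) :
    P.ring.valuation (n * x ^ (n - 1)) = 1 := by
  rw [map_mul, map_pow, hx, one_pow, mul_one, ← map_natCast (algebraMap ℂ X.Fun),
    P.valuation_algebraMap (Nat.cast_ne_zero.2 hn)]

/-- The quotient `(yⁿ - xⁿ) / (y - x)` is the unit `n xⁿ⁻¹` plus a vanishing term; `n` is a unit as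
a nonzero constant. -/
theorem valuation_pow_sub_pow {x y : X.Fun} (hx : P.ring.valuation x = 1)
    (hxy : P.ring.valuation (y - x) < 1) {n : ℕ} (hn : n ≠ 0) :
    P.ring.valuation (y ^ n - x ^ n) = P.ring.valuation (y - x) := by
  obtain ⟨k, hk, h⟩ := P.exists_add_pow_eq ((P.ring.valuation_le_one_iff _).1 hx.le)
    ((P.ring.valuation_le_one_iff _).1 hxy.le) n
  rw [add_sub_cancel] at h
  have h1 : y ^ n - x ^ n = (n * x ^ (n - 1) + k * (y - x)) * (y - x) := by
    rw [h]
    ring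
  have h2 : P.ring.valuation (k * (y - x)) < 1 := by
    rw [map_mul]
    exact (mul_le_of_le_one_left' ((P.ring.valuation_le_one_iff _).2 hk)).trans_lt hxy
  rw [h1, map_mul, Valuation.map_add_eq_of_lt_left _
    (by rwa [P.valuation_natCast_mul_pow hx hn]), P.valuation_natCast_mul_pow hx hn, one_mul]

/-- Over `ℂ`, `yⁿ - c` is a product of factors `y - r`, all holomorphic at `P`. If none vanished,
the product would have value one. -/
theorem exists_root_of_vanishes {y : X.Fun} {n : ℕ} (hn : n ≠ 0) {c : ℂ}
    (h : P.Vanishes (y ^ n - algebraMap ℂ X.Fun c)) :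
    ∃ r : ℂ, r ^ n = c ∧ P.Vanishes (y - algebraMap ℂ X.Fun r) := by
  set f : Polynomial ℂ := Polynomial.X ^ n - Polynomial.C c with hf
  have hmonic : f.Monic := Polynomial.monic_X_pow_sub_C c hn
  have hsplit := (IsAlgClosed.splits f).eq_prod_roots_of_monic hmonic
  have h1 : y ^ n - algebraMap ℂ X.Fun c =
      (f.roots.map fun r => y - algebraMap ℂ X.Fun r).prod := by
    have h2 : y ^ n - algebraMap ℂ X.Fun c = Polynomial.aeval y f := by simp [hf]
    rw [h2]
    conv_lhs => rw [hsplit]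
    rw [map_multiset_prod, Multiset.map_map]
    simp
  by_contra! hcon
  refine (ne_of_lt h) ?_
  rw [h1, map_multiset_prod, Multiset.map_map]
  refine Multiset.prod_eq_one fun x hx => ?_
  obtain ⟨r, hr, rfl⟩ := Multiset.mem_map.1 hx
  have hrn : r ^ n = c := by
    have := (Polynomial.mem_roots'.1 hr).2
    simpa [hf, sub_eq_zero] using this
  have hyr := hcon r hrn
  refine le_antisymm ?_ (not_lt.1 hyr)
  rw [Function.comp_apply, P.ring.valuation_le_one_iff]
  refine sub_mem ?_ (P.algebraMap_mem r)
  rw [← P.ring.valuation_le_one_iff]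
  refine (pow_le_one_iff hn).1 ?_
  rw [← map_pow, P.ring.valuation_le_one_iff]
  have := add_mem ((P.ring.valuation_le_one_iff _).1 h.le) (P.algebraMap_mem c)
  rwa [sub_add_cancel] at this

end RiemannSurface.Point

/-! ### Approximation at a point by functions from the base -/

namespace Cover

variable {X : RiemannSurface.{u}} {Y : RiemannSurface.{v}} (p : Cover Y X) (P : Y.Point)

theorem vanishes_onPoints_iff {f : X.Fun} :
    (p.onPoints P).Vanishes f ↔ P.Vanishes (p.pullback f) := by
  rw [RiemannSurface.Point.vanishes_iff, RiemannSurface.Point.vanishes_iff, ← map_inv₀,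
    map_eq_zero]
  rfl

/-- The functions on `Y` that are limits at `P` of functions on `X`, where `t` is a local
parameter on `X`. -/
def IsLimit (t : X.Fun) (f : Y.Fun) : Prop :=
  ∀ n : ℕ, ∃ a : X.Fun,
    P.ring.valuation (f - p.pullback a) ≤ P.ring.valuation (p.pullback t) ^ n

variable {p P} in
theorem IsLimit.add {t : X.Fun} {f g : Y.Fun} (hf : p.IsLimit P t f) (hg : p.IsLimit P t g) :
    p.IsLimit P t (f + g) := by
  intro n
  obtain ⟨a, ha⟩ := hf n
  obtain ⟨b, hb⟩ := hg n
  refine ⟨a + b, ?_⟩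
  rw [map_add, add_sub_add_comm]
  exact Valuation.map_add_le _ ha hb

theorem isLimit_pullback (t f : X.Fun) : p.IsLimit P t (p.pullback f) := fun n =>
  ⟨f, by simp⟩

/-- The values at `P` of the pulled back functions are the powers of the value of the pullback of
`t`, a function with a zero. -/
structure IsUniformizer (t : X.Fun) : Prop where
  ne_zero : t ≠ 0
  vanishes : P.Vanishes (p.pullback t)
  exists_zpow : ∀ f : X.Fun, f ≠ 0 →
    ∃ n : ℤ, P.ring.valuation (p.pullback f) = P.ring.valuation (p.pullback t) ^ n

namespace IsUniformizer

variable {p P} {t : X.Fun} (ht : p.IsUniformizer P t)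
include ht

theorem pullback_ne_zero : p.pullback t ≠ 0 := (map_ne_zero _).2 ht.ne_zero

theorem valuation_pos : 0 < P.ring.valuation (p.pullback t) := by
  simpa [zero_lt_iff] using ht.ne_zero

theorem isLocalParameter : (p.onPoints P).IsLocalParameter t := by
  refine ⟨(p.vanishes_onPoints_iff P).2 ht.vanishes,
    fun f hf => ⟨f / t, ?_, (div_mul_cancel₀ f ht.ne_zero).symm⟩⟩
  rw [vanishes_onPoints_iff] at hf
  change p.pullback (f / t) ∈ P.ring
  by_cases hf0 : f = 0
  · rw [hf0, zero_div, map_zero]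
    exact zero_mem _
  obtain ⟨n, hn⟩ := ht.exists_zpow f hf0
  rw [map_div₀]
  exact P.div_mem_of_valuation_le
    (P.valuation_le_of_eq_zpow ht.pullback_ne_zero ht.vanishes hf hn)

/-- Algebraicity gives a nonzero multiplier from the local ring below `P` that makes `f` integral,
hence holomorphic at `P`. So the powers of the value of `t` get below every nonzero value on `Y`,
which is why approximation to all orders controls values. -/
theorem exists_pow_mul_le_one (f : Y.Fun) :
    ∃ n : ℕ, P.ring.valuation f * P.ring.valuation (p.pullback t) ^ n ≤ 1 := by
  let := p.toAlgebra
  have := p.isAlgebraic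
  let A : ValuationSubring X.Fun := P.ring.comap p.pullback.toRingHom
  have hf : IsAlgebraic A f :=
    (IsFractionRing.isAlgebraic_iff A X.Fun Y.Fun).2 (Algebra.IsAlgebraic.isAlgebraic f)
  obtain ⟨y, hy0, hy⟩ := hf.exists_integral_multiple
  have hmem : p.pullback y * f ∈ P.ring := by
    have : IsIntegral P.ring (p.pullback y * f) := by
      obtain ⟨g, hg, hgy⟩ := hy
      refine ⟨g.map ((p.pullback.toRingHom.comp A.subtype).codRestrict P.ring.toSubring
        fun a => a.2), hg.map _, ?_⟩
      rw [Polynomial.eval₂_map]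
      rw [Algebra.smul_def] at hgy
      exact hgy
    obtain ⟨b, hb⟩ := IsIntegrallyClosed.isIntegral_iff.1 this
    rw [← hb]
    exact b.2
  have hy0' : (y : X.Fun) ≠ 0 := fun h => hy0 (Subtype.ext h)
  obtain ⟨n, hn⟩ := ht.exists_zpow y hy0'
  -- Raising the exponent only lowers the value, so the sign of `n` need not be discussed.
  refine ⟨n.toNat, ?_⟩
  rw [← P.ring.valuation_le_one_iff, map_mul, hn, mul_comm] at hmem
  refine le_trans (mul_le_mul_right ?_ _) hmem
  rw [← zpow_natCast]
  exact zpow_le_zpow_right_of_le_one₀ ht.valuation_pos ht.vanishes.le (Int.self_le_toNat n)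

theorem exists_zpow_of_isLimit {f : Y.Fun} (hf : p.IsLimit P t f) (hf0 : f ≠ 0) :
    ∃ n : ℤ, P.ring.valuation f = P.ring.valuation (p.pullback t) ^ n := by
  obtain ⟨n, hn⟩ := ht.exists_pow_mul_le_one f⁻¹
  -- The value of `f` is at least that of `tⁿ`; one more order makes the error strictly smaller than
  -- `f`, so `a` and `f` have equal values.
  obtain ⟨a, ha⟩ := hf (n + 1)
  have hlt : P.ring.valuation (f - p.pullback a) < P.ring.valuation f := by
    refine ha.trans_lt ?_
    have h0 : 0 < P.ring.valuation f := by simpa [zero_lt_iff] using hf0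
    rw [map_inv₀, inv_mul_le_one₀ h0] at hn
    refine lt_of_lt_of_le ?_ hn
    exact pow_lt_pow_right_of_lt_one₀ ht.valuation_pos ht.vanishes n.lt_succ_self
  have hva : P.ring.valuation (p.pullback a) = P.ring.valuation f := by
    have := Valuation.map_sub_eq_of_lt_left _ hlt
    rwa [sub_sub_cancel] at this
  have ha0 : a ≠ 0 := by
    rintro rfl
    rw [map_zero, map_zero, eq_comm, map_eq_zero] at hva
    exact hf0 hva
  rw [← hva]
  exact ht.exists_zpow a ha0

theorem isLimit_mul {f g : Y.Fun} (hf : p.IsLimit P t f) (hg : p.IsLimit P t g) :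
    p.IsLimit P t (f * g) := by
  intro n
  -- In `f g - a b = f (g - b) + b (f - a)`, `b` is fixed first, so that the precision required of
  -- `a` may depend on it.
  obtain ⟨k, hk⟩ := ht.exists_pow_mul_le_one f
  obtain ⟨b, hb⟩ := hg (k + n)
  obtain ⟨l, hl⟩ := ht.exists_pow_mul_le_one (p.pullback b)
  obtain ⟨a, ha⟩ := hf (l + n)
  refine ⟨a * b, ?_⟩
  have h : f * g - p.pullback (a * b) = f * (g - p.pullback b) + p.pullback b * (f - p.pullback a) := by
    rw [map_mul]
    ring
  rw [h]
  refine Valuation.map_add_le _ ?_ ?_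
  · rw [map_mul]
    refine (mul_le_mul_right hb _).trans ?_
    rw [pow_add, ← mul_assoc]
    exact mul_le_of_le_one_left' hk
  · rw [map_mul]
    refine (mul_le_mul_right ha _).trans ?_
    rw [pow_add, ← mul_assoc]
    exact mul_le_of_le_one_left' hl

/-- If the function field of `Y` is generated by limits of functions on `X`, then the cover is
unramified. -/
theorem unramifiedAt {S : Set Y.Fun}
    (hS : letI := p.toAlgebra; IntermediateField.adjoin X.Fun S = ⊤)
    (hlim : ∀ y ∈ S, p.IsLimit P t y) : p.UnramifiedAt P := by
  refine ⟨t, ht.isLocalParameter,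
    P.isLocalParameter_of_forall_eq_zpow ht.pullback_ne_zero ht.vanishes fun f hf =>
      ht.exists_zpow_of_isLimit ?_ hf⟩
  clear hf
  let := p.toAlgebra
  have := p.isAlgebraic
  -- For algebraic generators the generated ring is already the field, so limits need not be shown
  -- closed under inverses.
  have hS' : Algebra.adjoin X.Fun S = ⊤ := by
    rw [← IntermediateField.adjoin_toSubalgebra_of_isAlgebraic
      fun x _ => Algebra.IsAlgebraic.isAlgebraic x, hS, IntermediateField.top_toSubalgebra]
  have hf' : f ∈ Algebra.adjoin X.Fun S := hS' ▸ Algebra.mem_top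
  induction hf' using Algebra.adjoin_induction with
  | mem y hy => exact hlim y hy
  | algebraMap r => exact p.isLimit_pullback P t r
  | add x y _ _ hx hy => exact hx.add hy
  | mul x y _ _ hx hy => exact ht.isLimit_mul hx hy

/-- A root of a function on `X` with a finite nonzero value is a limit of functions on `X`. -/
theorem isLimit_of_pow_eq {y : Y.Fun} {N : ℕ} (hN : N ≠ 0) {g : X.Fun} (hy : y ^ N = p.pullback g)
    {c : ℂ} (hc : c ≠ 0) (hg : P.Vanishes (p.pullback g - algebraMap ℂ Y.Fun c)) :
    p.IsLimit P t y := by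
  have hvc : P.ring.valuation (p.pullback g) = 1 := by
    rw [← P.valuation_algebraMap hc]
    have h := Valuation.map_add_eq_of_lt_left P.ring.valuation
      (lt_of_lt_of_eq hg (P.valuation_algebraMap hc).symm)
    rwa [add_sub_cancel] at h
  have hvy : P.ring.valuation y = 1 := P.valuation_eq_one_of_pow hN (by rw [hy, hvc])
  have hva : ∀ a : X.Fun, P.ring.valuation (y - p.pullback a) < 1 →
      P.ring.valuation (p.pullback a) = 1 := fun a ha => by
    have h := Valuation.map_sub_eq_of_lt_left P.ring.valuation (ha.trans_eq hvy.symm)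
    rwa [sub_sub_cancel, hvy] at h
  -- A constant `r` with `r ^ N = c` is the first approximation. Its error has the value of `g - r ^
  -- N`, a function on `X`, hence is zero or vanishes to order at least one in `t`.
  have hstart : ∃ a : X.Fun, P.ring.valuation (y - p.pullback a) ≤
      P.ring.valuation (p.pullback t) := by
    rw [← hy] at hg
    obtain ⟨r, hr, hyr⟩ := P.exists_root_of_vanishes hN hg
    rw [← p.pullback.commutes] at hyr
    refine ⟨algebraMap ℂ X.Fun r, ?_⟩
    have h1 := P.valuation_pow_sub_pow (hva _ hyr) hyr hN
    rw [hy, ← map_pow, ← map_sub] at h1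
    by_cases h0 : g - algebraMap ℂ X.Fun r ^ N = 0
    · rw [← h1, h0, map_zero, map_zero]
      exact zero_le
    · obtain ⟨n, hn⟩ := ht.exists_zpow _ h0
      exact P.valuation_le_of_eq_zpow ht.pullback_ne_zero ht.vanishes hyr (h1.symm.trans hn)
  have hstep : ∀ n : ℕ, ∃ a : X.Fun, P.ring.valuation (y - p.pullback a) ≤
      P.ring.valuation (p.pullback t) ^ (n + 1) := fun n => by
    induction n with
    | zero => simpa using hstart
    | succ n ih =>
      obtain ⟨a, ha⟩ := ih
      have hlt : P.ring.valuation (y - p.pullback a) < 1 :=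
        ha.trans_lt (pow_lt_one₀ zero_le ht.vanishes n.succ_ne_zero)
      have ha1 := hva a hlt
      obtain ⟨k, hk, h⟩ := P.exists_add_pow_eq ((P.ring.valuation_le_one_iff _).1 ha1.le)
        ((P.ring.valuation_le_one_iff _).1 hlt.le) N
      rw [add_sub_cancel] at h
      have hd := P.valuation_natCast_mul_pow ha1 hN
      have hd0 : (N : Y.Fun) * p.pullback a ^ (N - 1) ≠ 0 := fun h => by simp [h] at hd
      -- The Newton step for `T ^ N - g` at `a`. The error is squared up to a holomorphic factor, so
      -- order `n + 1` becomes `2 (n + 1) ≥ n + 2`.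
      refine ⟨a + (g - a ^ N) / (N * a ^ (N - 1)), ?_⟩
      have h1 : y - p.pullback (a + (g - a ^ N) / (N * a ^ (N - 1))) =
          -(k * (y - p.pullback a) ^ 2) / (N * p.pullback a ^ (N - 1)) := by
        rw [map_add, map_div₀, map_sub, ← hy, h, map_mul, map_pow, map_pow, map_natCast,
          eq_div_iff hd0, sub_mul, add_mul, div_mul_cancel₀ _ hd0]
        ring
      rw [h1, map_div₀, hd, div_one, Valuation.map_neg, map_mul, map_pow]
      refine (mul_le_of_le_one_left' ((P.ring.valuation_le_one_iff _).2 hk)).trans ?_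
      refine (pow_le_pow_left₀ zero_le ha 2).trans ?_
      rw [← pow_mul]
      exact pow_le_pow_right_of_le_one' ht.vanishes.le (by omega)
  intro n
  obtain ⟨a, ha⟩ := hstep n
  exact ⟨a, ha.trans (pow_le_pow_right_of_le_one' ht.vanishes.le n.le_succ)⟩

end IsUniformizer

end Cover

/-! ### Covers of the sphere -/

theorem RiemannSurface.Point.vanishes_aeval_sub {X : RiemannSurface.{u}} (P : X.Point) {f : X.Fun}
    {c : ℂ} (h : P.Vanishes (f - algebraMap ℂ X.Fun c)) (G : Polynomial ℂ) :
    P.Vanishes (Polynomial.aeval f G - algebraMap ℂ X.Fun (G.eval c)) := by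
  have hf : f ∈ P.ring := by
    have := add_mem ((P.ring.valuation_le_one_iff _).1 h.le) (P.algebraMap_mem c)
    rwa [sub_add_cancel] at this
  obtain ⟨H, hH⟩ := Polynomial.X_sub_C_dvd_sub_C_eval (a := c) (p := G)
  have h1 := congrArg (Polynomial.aeval f) hH
  rw [map_sub, map_mul, map_sub, Polynomial.aeval_C, Polynomial.aeval_C, Polynomial.aeval_X] at h1
  rw [h1]
  change P.ring.valuation _ < 1
  rw [map_mul]
  exact (mul_le_of_le_one_right' ((P.ring.valuation_le_one_iff _).2 (P.aeval_mem hf H))).trans_lt h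

namespace Cover

variable {Y : RiemannSurface.{u}} (p : Cover Y sphere) (P : Y.Point)

theorem pullback_algebraMap_polynomial (G : Polynomial ℂ) :
    p.pullback (algebraMap (Polynomial ℂ) (RatFunc ℂ) G) = Polynomial.aeval p.z G := by
  have h : algebraMap (Polynomial ℂ) (RatFunc ℂ) G = Polynomial.aeval (RatFunc.X : RatFunc ℂ) G := by
    rw [← RatFunc.algebraMap_X, Polynomial.aeval_algebraMap_apply, Polynomial.aeval_X_left_apply]
  rw [h]
  exact (Polynomial.aeval_algHom_apply p.pullback coord G).symm

/-- A rational function over `ℂ` is a constant times integer powers of factors `z - c`, and nonzero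
constants have value one. -/
theorem exists_zpow_of_forall_sub {b : P.ring.ValueGroup} (hb0 : b ≠ 0)
    (h : ∀ c : ℂ, ∃ n : ℤ, P.ring.valuation (p.z - algebraMap ℂ Y.Fun c) = b ^ n)
    (f : sphere.Fun) (hf : f ≠ 0) : ∃ n : ℤ, P.ring.valuation (p.pullback f) = b ^ n := by
  have hpoly : ∀ G : Polynomial ℂ, G ≠ 0 →
      ∃ n : ℤ, P.ring.valuation (Polynomial.aeval p.z G) = b ^ n := by
    intro G hG
    have hprod : ∀ s : Multiset ℂ, ∃ n : ℤ,
        P.ring.valuation (s.map fun c => p.z - algebraMap ℂ Y.Fun c).prod = b ^ n := by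
      intro s
      induction s using Multiset.induction with
      | empty => exact ⟨0, by simp⟩
      | cons c s ih =>
        obtain ⟨k, hk⟩ := h c
        obtain ⟨n, hn⟩ := ih
        exact ⟨k + n, by rw [Multiset.map_cons, Multiset.prod_cons, map_mul, hk, hn,
          zpow_add₀ hb0]⟩
    obtain ⟨n, hn⟩ := hprod G.roots
    refine ⟨n, ?_⟩
    conv_lhs => rw [(IsAlgClosed.splits G).eq_prod_roots]
    rw [map_mul, Polynomial.aeval_C, map_mul,
      P.valuation_algebraMap (Polynomial.leadingCoeff_ne_zero.2 hG), one_mul, map_multiset_prod,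
      Multiset.map_map]
    simpa [Function.comp_def] using hn
  obtain ⟨G, H, hH, rfl⟩ := IsFractionRing.div_surjective (A := Polynomial ℂ) (K := RatFunc ℂ) f
  have hG : G ≠ 0 := by
    rintro rfl
    exact hf (show _ = (0 : RatFunc ℂ) by rw [map_zero, zero_div])
  obtain ⟨k, hk⟩ := hpoly G hG
  obtain ⟨l, hl⟩ := hpoly H (nonZeroDivisors.ne_zero hH)
  refine ⟨k - l, ?_⟩
  have h1 : p.pullback (algebraMap (Polynomial ℂ) (RatFunc ℂ) G /
      algebraMap (Polynomial ℂ) (RatFunc ℂ) H) =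
      Polynomial.aeval p.z G / Polynomial.aeval p.z H := by
    rw [← pullback_algebraMap_polynomial, ← pullback_algebraMap_polynomial]
    exact map_div₀ p.pullback _ _
  rw [zpow_sub₀ hb0, ← hk, ← hl, ← map_div₀ P.ring.valuation]
  exact congrArg _ h1

/-- Otherwise every `z - c` would have value one, so all of `ℂ(z)` would be holomorphic at the image
point. -/
theorem exists_vanishes_sub (hz : p.z ∈ P.ring) :
    ∃ c : ℂ, P.Vanishes (p.z - algebraMap ℂ Y.Fun c) := by
  by_contra! hcon
  have h1 : ∀ c : ℂ, ∃ n : ℤ,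
      P.ring.valuation (p.z - algebraMap ℂ Y.Fun c) = (1 : P.ring.ValueGroup) ^ n := fun c => by
    refine ⟨0, ?_⟩
    rw [zpow_zero]
    exact le_antisymm ((P.ring.valuation_le_one_iff _).2 (sub_mem hz (P.algebraMap_mem c)))
      (not_lt.1 (hcon c))
  refine (p.onPoints P).ne_top (SetLike.ext fun f => ⟨fun _ => trivial, fun _ => ?_⟩)
  change p.pullback f ∈ P.ring
  by_cases hf : f = 0
  · rw [hf, map_zero]
    exact zero_mem _
  · obtain ⟨n, hn⟩ := p.exists_zpow_of_forall_sub P one_ne_zero h1 f hf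
    rw [← P.ring.valuation_le_one_iff, hn, one_zpow]

theorem isUniformizer_coord_sub {c : ℂ} (hc : P.Vanishes (p.z - algebraMap ℂ Y.Fun c)) :
    p.IsUniformizer P (coord - algebraMap ℂ sphere.Fun c) := by
  have hpull : p.pullback (coord - algebraMap ℂ sphere.Fun c) = p.z - algebraMap ℂ Y.Fun c := by
    rw [map_sub, p.pullback.commutes, z]
  have h0 := p.z_sub_ne_zero c
  refine ⟨fun h => h0 (by rw [← hpull, h, map_zero]), hpull ▸ hc, ?_⟩
  rw [hpull]
  refine p.exists_zpow_of_forall_sub P (by simpa using h0) fun a => ?_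
  by_cases hac : a = c
  · exact ⟨1, by rw [hac, zpow_one]⟩
  · refine ⟨0, ?_⟩
    have h1 : P.ring.valuation (algebraMap ℂ Y.Fun (c - a)) = 1 :=
      P.valuation_algebraMap (sub_ne_zero.2 (Ne.symm hac))
    have h2 := Valuation.map_add_eq_of_lt_left P.ring.valuation (lt_of_lt_of_eq hc h1.symm)
    have h3 : p.z - algebraMap ℂ Y.Fun a =
        algebraMap ℂ Y.Fun (c - a) + (p.z - algebraMap ℂ Y.Fun c) := by
      rw [map_sub]
      ring
    rw [zpow_zero, h3, h2, h1]

theorem vanishes_inv_z (hz : p.z ∉ P.ring) : P.Vanishes p.z⁻¹ :=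
  P.vanishes_iff.2 (Or.inr (by rwa [inv_inv]))

theorem isUniformizer_inv_coord (hz : p.z ∉ P.ring) : p.IsUniformizer P coord⁻¹ := by
  have hpull : p.pullback coord⁻¹ = p.z⁻¹ := map_inv₀ _ _
  have hv := p.vanishes_inv_z P hz
  have h0 : p.z ≠ 0 := fun h => hz (h ▸ zero_mem _)
  refine ⟨fun h => inv_ne_zero h0 (by rw [← hpull, h, map_zero]), hpull ▸ hv, ?_⟩
  rw [hpull]
  refine p.exists_zpow_of_forall_sub P (by simpa using h0) fun a => ⟨-1, ?_⟩
  have h1 : P.ring.valuation (algebraMap ℂ Y.Fun a * p.z⁻¹) < 1 := by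
    rw [map_mul]
    exact (mul_le_of_le_one_left' (P.valuation_algebraMap_le_one _)).trans_lt hv
  have h2 : p.z - algebraMap ℂ Y.Fun a = p.z * (1 - algebraMap ℂ Y.Fun a * p.z⁻¹) := by
    field_simp
  rw [h2, map_mul, Valuation.map_one_sub_of_lt _ h1, mul_one, map_inv₀, zpow_neg_one, inv_inv]

/-- A cover generated by `N`-th roots of products of powers of `z - z₁, …, z - z₄` whose degrees are
divisible by `N` is branched at most over `z₁, …, z₄`. -/
theorem unramifiedAt_of_roots (a : Fin 4 → ℂ) {ι : Type*} (y : ι → Y.Fun) {N : ℕ} (hN : N ≠ 0)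
    (k : ι → Fin 4 → ℕ) (hk : ∀ i, N ∣ ∑ j, k i j)
    (hy : ∀ i, y i ^ N = ∏ j, (p.z - algebraMap ℂ Y.Fun (a j)) ^ k i j)
    (hgen : letI := p.toAlgebra; IntermediateField.adjoin sphere.Fun (Set.range y) = ⊤)
    (hP : ∀ j, ¬ (p.onPoints P).Vanishes (coord - algebraMap ℂ sphere.Fun (a j))) :
    p.UnramifiedAt P := by
  by_cases hz : p.z ∈ P.ring
  · obtain ⟨c, hc⟩ := p.exists_vanishes_sub P hz
    refine (p.isUniformizer_coord_sub P hc).unramifiedAt hgen ?_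
    rintro _ ⟨i, rfl⟩
    let G : Polynomial ℂ := ∏ j, (Polynomial.X - Polynomial.C (a j)) ^ k i j
    have hG : p.pullback (algebraMap (Polynomial ℂ) (RatFunc ℂ) G) = y i ^ N := by
      rw [pullback_algebraMap_polynomial, hy]
      simp [G]
    refine (p.isUniformizer_coord_sub P hc).isLimit_of_pow_eq hN hG.symm (c := G.eval c) ?_ ?_
    · rw [Polynomial.eval_prod, Finset.prod_ne_zero_iff]
      intro j _
      rw [Polynomial.eval_pow, Polynomial.eval_sub, Polynomial.eval_X, Polynomial.eval_C]
      refine pow_ne_zero _ (sub_ne_zero.2 ?_)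
      rintro rfl
      refine hP j ((p.vanishes_onPoints_iff P).2 ?_)
      rw [map_sub, p.pullback.commutes]
      exact hc
    · have := P.vanishes_aeval_sub hc G
      rwa [← pullback_algebraMap_polynomial] at this
  · have ht := p.isUniformizer_inv_coord P hz
    have h0 : p.z ≠ 0 := fun h => hz (h ▸ zero_mem _)
    refine ht.unramifiedAt hgen ?_
    rintro _ ⟨i, rfl⟩
    -- Over infinity `y i` may have a pole. As its radicand has degree `N * l`, dividing by `z ^ l`
    -- leaves an `N`-th root of `∏ (1 - z_j / z) ^ k i j`, whose value at infinity is 1; the factor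
    -- `z ^ l` is restored at the end.
    obtain ⟨l, hl⟩ := hk i
    let G : Polynomial ℂ := ∏ j, (1 - Polynomial.C (a j) * Polynomial.X) ^ k i j
    have hG : p.pullback (Polynomial.aeval coord⁻¹ G) = Polynomial.aeval p.z⁻¹ G := by
      rw [← Polynomial.aeval_algHom_apply, map_inv₀, z]
    have hyG : (y i * p.z⁻¹ ^ l) ^ N = p.pullback (Polynomial.aeval coord⁻¹ G) := by
      rw [hG, mul_pow, hy, ← pow_mul, mul_comm l N, ← hl, ← Finset.prod_pow_eq_pow_sum,
        ← Finset.prod_mul_distrib, map_prod]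
      refine Finset.prod_congr rfl fun j _ => ?_
      rw [← mul_pow, map_pow, map_sub, map_mul, map_one, Polynomial.aeval_C, Polynomial.aeval_X,
        sub_mul, mul_inv_cancel₀ h0]
    have hv : P.Vanishes (p.z⁻¹ - algebraMap ℂ Y.Fun 0) := by
      rw [map_zero, sub_zero]
      exact p.vanishes_inv_z P hz
    have h1 : G.eval 0 = 1 := by
      simp [G, Polynomial.eval_prod]
    have hlim : p.IsLimit P coord⁻¹ (y i * p.z⁻¹ ^ l) := by
      refine ht.isLimit_of_pow_eq hN hyG (c := G.eval 0) (h1 ▸ one_ne_zero) ?_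
      rw [hG]
      exact P.vanishes_aeval_sub hv G
    have := ht.isLimit_mul hlim (p.isLimit_pullback P coord⁻¹ (coord ^ l))
    rwa [map_pow, ← z, mul_assoc, ← mul_pow, inv_mul_cancel₀ h0, one_pow, mul_one] at this

end Cover

/-! ### Covers generated by a square root -/

namespace Cover

variable {X : RiemannSurface.{u}} {Y : RiemannSurface.{v}} {Z : RiemannSurface.{w}} {p : Cover Y X}
  {g : X.Fun} {s : Y.Fun}

/-- Over `Z` the polynomial `X² - g` splits as `(X - t)(X + t)`, hence so does the minimal
polynomial of the generator `s`, and `s` can be sent to a root. -/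
theorem exists_comp_eq_of_sq (hs : s ^ 2 = p.pullback g)
    (hgen : letI := p.toAlgebra; IntermediateField.adjoin X.Fun {s} = ⊤) (r : Cover Z X)
    {t : Z.Fun} (ht : t ^ 2 = r.pullback g) : ∃ q : Cover Z Y, p.comp q = r := by
  let := p.toAlgebra
  let := r.toAlgebra
  have hdvd : minpoly X.Fun s ∣ Polynomial.X ^ 2 - Polynomial.C g := by
    refine minpoly.dvd _ _ ?_
    rw [map_sub, map_pow, Polynomial.aeval_X, Polynomial.aeval_C, hs]
    exact sub_self _
  have hsplits : (Polynomial.map (algebraMap X.Fun Z.Fun) (minpoly X.Fun s)).Splits := by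
    have h1 : Polynomial.map (algebraMap X.Fun Z.Fun) (Polynomial.X ^ 2 - Polynomial.C g) =
        (Polynomial.X - Polynomial.C t) * (Polynomial.X - Polynomial.C (-t)) := by
      have h2 : algebraMap X.Fun Z.Fun g = t ^ 2 := ht.symm
      rw [Polynomial.map_sub, Polynomial.map_pow, Polynomial.map_X, Polynomial.map_C, h2,
        Polynomial.C_pow, Polynomial.C_neg]
      ring
    have h3 := Polynomial.map_dvd (algebraMap X.Fun Z.Fun) hdvd
    rw [h1] at h3
    exact Polynomial.Splits.of_dvd ((Polynomial.Splits.X_sub_C t).mul (Polynomial.Splits.X_sub_C (-t)))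
      (mul_ne_zero (Polynomial.X_sub_C_ne_zero t) (Polynomial.X_sub_C_ne_zero (-t))) h3
  have hint : IsIntegral X.Fun s :=
    ⟨Polynomial.X ^ 2 - Polynomial.C g, Polynomial.monic_X_pow_sub_C g two_ne_zero,
      (minpoly.dvd_iff).1 hdvd⟩
  obtain ⟨q⟩ := IntermediateField.nonempty_algHom_of_adjoin_splits
    (fun x hx => by rw [Set.mem_singleton_iff.1 hx]; exact ⟨hint, hsplits⟩) hgen
  refine ⟨⟨{ q.toRingHom with commutes' := fun c => ?_ }⟩, ?_⟩
  · have h := q.commutes (algebraMap ℂ X.Fun c)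
    change q (p.pullback (algebraMap ℂ X.Fun c)) = r.pullback (algebraMap ℂ X.Fun c) at h
    rwa [p.pullback.commutes, r.pullback.commutes] at h
  · have h : ∀ x, q (p.pullback x) = r.pullback x := q.commutes
    cases r
    exact congrArg Cover.mk (AlgHom.ext h)

theorem degree_eq_one_of_sq (hs : s ^ 2 = p.pullback g)
    (hgen : letI := p.toAlgebra; IntermediateField.adjoin X.Fun {s} = ⊤) {f : X.Fun}
    (hf : f ^ 2 = g) : p.degree = 1 := by
  let := p.toAlgebra
  have hmem : s ∈ (⊥ : IntermediateField X.Fun Y.Fun) := by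
    rw [← hf, map_pow, sq_eq_sq_iff_eq_or_eq_neg] at hs
    have hpf : p.pullback f ∈ (⊥ : IntermediateField X.Fun Y.Fun) :=
      IntermediateField.algebraMap_mem _ f
    rcases hs with rfl | rfl
    · exact hpf
    · exact neg_mem hpf
  have h : (⊤ : IntermediateField X.Fun Y.Fun) = ⊥ := by
    rw [← hgen]
    exact IntermediateField.adjoin_simple_eq_bot_iff.2 hmem
  change Module.finrank X.Fun Y.Fun = 1
  rw [← IntermediateField.finrank_top', h, IntermediateField.finrank_bot]

theorem degree_eq_two_of_not_sq (hs : s ^ 2 = p.pullback g)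
    (hgen : letI := p.toAlgebra; IntermediateField.adjoin X.Fun {s} = ⊤)
    (hg : ¬ ∃ f : X.Fun, f ^ 2 = g) : p.degree = 2 := by
  let := p.toAlgebra
  have hmonic := Polynomial.monic_X_pow_sub_C g two_ne_zero
  have hroot : Polynomial.aeval s (Polynomial.X ^ 2 - Polynomial.C g) = 0 := by
    rw [map_sub, map_pow, Polynomial.aeval_X, Polynomial.aeval_C, hs]
    exact sub_self _
  have hirr : Irreducible (Polynomial.X ^ 2 - Polynomial.C g) :=
    X_pow_sub_C_irreducible_of_prime Nat.prime_two fun f hf => hg ⟨f, hf⟩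
  change Module.finrank X.Fun Y.Fun = 2
  rw [← IntermediateField.finrank_top', ← hgen,
    IntermediateField.adjoin.finrank ⟨_, hmonic, hroot⟩,
    ← minpoly.eq_of_irreducible_of_monic hirr hroot hmonic, Polynomial.natDegree_X_pow_sub_C]

end Cover

/-! ### Abelian covers -/

/-- Two elements of an extension field of `ℂ` with the same `n`-th power differ by a constant. -/
theorem exists_eq_algebraMap_mul_of_pow_eq {F : Type u} [Field F] [Algebra ℂ F] {x y : F} {n : ℕ}
    (hn : n ≠ 0) (h : x ^ n = y ^ n) : ∃ c : ℂ, x = algebraMap ℂ F c * y := by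
  by_cases hy : y = 0
  · rw [hy, zero_pow hn] at h
    exact ⟨0, by rw [eq_zero_of_pow_eq_zero h, hy, mul_zero]⟩
  have h1 : (x / y) ^ n = 1 := by rw [div_pow, h, div_self (pow_ne_zero n hy)]
  -- The ratio is a root of unity, thus algebraic over the algebraically closed field `ℂ`.
  have hint : IsIntegral ℂ (x / y) := by
    refine ⟨Polynomial.X ^ n - Polynomial.C 1, Polynomial.monic_X_pow_sub_C 1 hn, ?_⟩
    simp [h1]
  obtain ⟨c, hc⟩ := minpoly.mem_range_of_degree_eq_one ℂ (x / y)
    (IsAlgClosed.degree_eq_one_of_irreducible ℂ (minpoly.irreducible hint))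
  exact ⟨c, by rw [hc, div_mul_cancel₀ _ hy]⟩

section

variable {a : Fin 4 → ℂ} {N m : ℕ} {A : Matrix (Fin m) (Fin 4) (ZMod N)} (W : RootChoice a A)

theorem RowSumsZero.dvd_sum_val [NeZero N] (hA : RowSumsZero A) (i : Fin m) :
    N ∣ ∑ j, (A i j).val := by
  rw [← ZMod.natCast_eq_zero_iff, Nat.cast_sum]
  simpa using hA i

theorem rowSumsZero_of_dvd [NeZero N] (h : ∀ i, N ∣ ∑ j, (A i j).val) : RowSumsZero A := fun i => by
  have := h i
  rw [← ZMod.natCast_eq_zero_iff, Nat.cast_sum] at this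
  simpa using this

/-- The function `wᵢ` on `M_N(A)`. -/
def RootChoice.gen (i : Fin m) : (abelianCover W).Fun :=
  (⟨W.w i, IntermediateField.subset_adjoin _ _ ⟨i, rfl⟩⟩ : funField W)

theorem RootChoice.gen_pow (i : Fin m) : W.gen i ^ N =
    ∏ j, ((covering W).z - algebraMap ℂ (abelianCover W).Fun (a j)) ^ (A i j).val := by
  have h : W.gen i ^ N = (covering W).pullback
      (∏ j, (coord - algebraMap ℂ sphere.Fun (a j)) ^ (A i j).val) := Subtype.ext (W.w_pow i)
  rw [h]
  simp [Cover.z]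

/-- Phrased for bare subfields so as to apply both to the equalizer of two automorphisms and to
fields generated over a base other than `ℂ(z)`. -/
theorem RootChoice.mem_subfield (T : Subfield (abelianCover W).Fun)
    (hT : ∀ f, (covering W).pullback f ∈ T) (hw : ∀ i, W.gen i ∈ T) (f : (abelianCover W).Fun) :
    f ∈ T := by
  obtain ⟨f, hf⟩ := f
  induction hf using IntermediateField.adjoin_induction with
  | mem x hx =>
    obtain ⟨i, rfl⟩ := hx
    exact hw i
  | algebraMap x => exact hT x
  | add x y hx hy ihx ihy => exact T.add_mem ihx ihy
  | inv x hx ihx => exact T.inv_mem ihx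
  | mul x y hx hy ihx ihy => exact T.mul_mem ihx ihy

theorem RootChoice.adjoin_gen_eq_top :
    letI := (covering W).toAlgebra
    IntermediateField.adjoin sphere.Fun (Set.range W.gen) = ⊤ := by
  let := (covering W).toAlgebra
  refine top_le_iff.1 fun f _ => W.mem_subfield
    (IntermediateField.adjoin sphere.Fun (Set.range W.gen)).toSubfield (fun g => ?_) (fun i => ?_) f
  · exact IntermediateField.algebraMap_mem _ g
  · exact IntermediateField.subset_adjoin _ _ ⟨i, rfl⟩

/-- Each conjugate of `w_i` has the same `N`-th power, so it is a constant multiple of `w_i` and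
stays in the field. -/
theorem isGalois_funField (hN : N ≠ 0) : IsGalois (RatFunc ℂ) (funField W) := by
  have : Normal (RatFunc ℂ) (funField W) := by
    refine IntermediateField.normal_iff_forall_map_le.2 fun σ => ?_
    rw [IntermediateField.adjoin_map, IntermediateField.adjoin_le_iff]
    rintro _ ⟨_, ⟨i, rfl⟩, rfl⟩
    have h : σ (W.w i) ^ N = W.w i ^ N := by
      rw [← map_pow, W.w_pow, σ.commutes]
    obtain ⟨c, hc⟩ := exists_eq_algebraMap_mul_of_pow_eq hN h
    change σ (W.w i) ∈ funField W
    rw [hc, IsScalarTower.algebraMap_apply ℂ (RatFunc ℂ) (AlgebraicClosure (RatFunc ℂ))]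
    exact mul_mem (IntermediateField.algebraMap_mem _ _)
      (IntermediateField.subset_adjoin _ _ ⟨i, rfl⟩)
  exact {}

/-- Automorphisms fix constants and scale each `w_i` by a constant, and such scalings commute. -/
theorem isAbelianGalois_funField (hN : N ≠ 0) : IsAbelianGalois (RatFunc ℂ) (funField W) := by
  have := isGalois_funField W hN
  let g : Fin m → funField W := W.gen
  have hgen : ∀ (σ : Gal((funField W)/(RatFunc ℂ))) (i : Fin m), ∃ c : ℂ,
      σ (g i) = algebraMap ℂ (funField W) c * g i := fun σ i => by
    refine exists_eq_algebraMap_mul_of_pow_eq hN ?_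
    have h : g i ^ N = algebraMap (RatFunc ℂ) (funField W)
      (∏ j, (RatFunc.X - RatFunc.C (a j)) ^ (A i j).val) := Subtype.ext (W.w_pow i)
    exact (map_pow σ _ N).symm.trans ((congrArg σ h).trans ((σ.commutes _).trans h.symm))
  have hconst : ∀ (σ : Gal((funField W)/(RatFunc ℂ))) (c : ℂ),
      σ (algebraMap ℂ (funField W) c) = algebraMap ℂ (funField W) c := fun σ c => by
    rw [IsScalarTower.algebraMap_apply ℂ (RatFunc ℂ) (funField W)]
    exact σ.commutes _
  have hcomm : ∀ σ τ : Gal((funField W)/(RatFunc ℂ)), σ * τ = τ * σ := fun σ τ => by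
    refine AlgEquiv.ext fun f => ?_
    refine W.mem_subfield (RingHom.eqLocusField
      ((σ * τ : Gal((funField W)/(RatFunc ℂ))) : funField W →+* funField W)
      ((τ * σ : Gal((funField W)/(RatFunc ℂ))) : funField W →+* funField W))
      (fun f => ?_) (fun i => ?_) f
    · exact ((σ * τ).commutes f).trans ((τ * σ).commutes f).symm
    · change σ (τ (g i)) = τ (σ (g i))
      obtain ⟨c, hc⟩ := hgen σ i
      obtain ⟨d, hd⟩ := hgen τ i
      rw [hc, hd, map_mul, map_mul, hconst, hconst, hc, hd]
      ring
  exact { is_comm := ⟨hcomm⟩ }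

theorem isNormalAbelian_covering (hN : N ≠ 0) : (covering W).IsNormalAbelian := by
  have h : (covering W).toAlgebra = (inferInstance : Algebra (RatFunc ℂ) (funField W)) :=
    Algebra.algebra_ext _ _ fun _ => rfl
  change @IsAbelianGalois (RatFunc ℂ) (funField W) _ _ (covering W).toAlgebra
  rw [h]
  exact isAbelianGalois_funField W hN

theorem isAbelianSquareTiled_covering (hN : N ≠ 0) (hA : RowSumsZero A) :
    IsAbelianSquareTiled a (covering W) := by
  have : NeZero N := ⟨hN⟩
  exact ⟨isNormalAbelian_covering W hN, fun P hP =>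
    (covering W).unramifiedAt_of_roots P a W.gen hN (fun i j => (A i j).val) hA.dvd_sum_val
      W.gen_pow W.adjoin_gen_eq_top hP⟩

end

/-! ### The holonomy cover -/

section

variable {a : Fin 4 → ℂ} {N N' m : ℕ} {A : Matrix (Fin m) (Fin 4) (ZMod N)}
  {A' : Matrix (Fin (m + 1)) (Fin 4) (ZMod N')} {W : RootChoice a A} {W' : RootChoice a A'}

/-- The inclusion of function fields, as a cover. -/
def coverOfLE (h : funField W ≤ funField W') : Cover (abelianCover W') (abelianCover W) where
  pullback := ((IntermediateField.inclusion h).restrictScalars ℂ :)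

theorem covering_comp_coverOfLE (h : funField W ≤ funField W') :
    (covering W).comp (coverOfLE h) = covering W' := rfl

/-- The common form of both parities: `d = 1`, `M = N / 2` for even `N`, and `d = 2`, `M = N` for
odd `N`. Working with integer lifts turns the rows into honest identities of exponents. -/
theorem holonomyCoverIs_of_val (ha : Function.Injective a) {d M : ℕ} (hN' : N' ≠ 0)
    (hd : N' = d * N) (hM : N' = 2 * M) (hA : RowSumsZero A)
    (hcast : ∀ i j, (A' (Fin.castSucc i) j).val = d * (A i j).val)
    (hlast : ∀ j, (A' (Fin.last m) j).val = M) : HolonomyCoverIs a A A' := by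
  have : NeZero N' := ⟨hN'⟩
  have hN : NeZero N := ⟨by rintro rfl; exact hN' hd⟩
  have hM0 : M ≠ 0 := by rintro rfl; exact hN' hM
  have hA' : RowSumsZero A' := by
    refine rowSumsZero_of_dvd fun i => ?_
    refine Fin.lastCases ?_ (fun i => ?_) i
    · simp only [hlast, Fin.sum_univ_four]
      exact ⟨2, by omega⟩
    · simp only [hcast, ← Finset.mul_sum]
      rw [hd]
      exact mul_dvd_mul_left d (hA.dvd_sum_val i)
  refine ⟨hA', fun W W' => ⟨isAbelianSquareTiled_covering W' hN' hA', ?_⟩⟩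
  -- Equal `N'`-th powers make the two roots proportional over `ℂ`, whichever branches `W` and `W'`
  -- have chosen.
  have hpow : ∀ i : Fin m, W.w i ^ N' = W'.w (Fin.castSucc i) ^ N' := fun i => by
    have h : W.w i ^ N' = (W.w i ^ N) ^ d := by rw [← pow_mul, mul_comm N d, hd]
    rw [W'.w_pow, h, W.w_pow, ← map_pow, ← Finset.prod_pow]
    simp only [hcast, ← pow_mul, mul_comm d]
  have hle : funField W ≤ funField W' := by
    rw [IntermediateField.adjoin_le_iff]
    rintro _ ⟨i, rfl⟩
    obtain ⟨c, hc⟩ := exists_eq_algebraMap_mul_of_pow_eq hN' (hpow i)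
    rw [hc, IsScalarTower.algebraMap_apply ℂ (RatFunc ℂ) (AlgebraicClosure (RatFunc ℂ))]
    exact mul_mem (IntermediateField.algebraMap_mem _ _)
      (IntermediateField.subset_adjoin _ _ ⟨_, rfl⟩)
  set p := coverOfLE hle
  have hcomp : (covering W).comp p = covering W' := covering_comp_coverOfLE hle
  have hquartic : (covering W').quartic a = p.pullback ((covering W).quartic a) :=
    (covering W).quartic_comp a p
  obtain ⟨e, he⟩ : ∃ e : ℂ, W'.gen (Fin.last m) ^ 2 =
      algebraMap ℂ (abelianCover W').Fun e * (covering W').quartic a := by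
    refine exists_eq_algebraMap_mul_of_pow_eq hM0 ?_
    rw [← pow_mul, ← hM, W'.gen_pow]
    simp only [hlast]
    rw [Finset.prod_pow]
    rfl
  have he0 : e ≠ 0 := by
    rintro rfl
    rw [map_zero, zero_mul, sq_eq_zero_iff] at he
    have h := W'.gen_pow (Fin.last m)
    rw [he, zero_pow hN', eq_comm, Finset.prod_eq_zero_iff] at h
    obtain ⟨j, -, hj⟩ := h
    exact (covering W').z_sub_ne_zero (a j) (eq_zero_of_pow_eq_zero hj)
  -- Rescaling the last generator by a square root of `e` gives an exact square root `s` of `Q`.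
  obtain ⟨c, rfl⟩ := IsAlgClosed.exists_pow_nat_eq e two_pos
  have hc0 : algebraMap ℂ (abelianCover W').Fun c ≠ 0 := by
    rintro h
    rw [map_eq_zero] at h
    exact he0 (by rw [h]; simp)
  set s := (algebraMap ℂ (abelianCover W').Fun c)⁻¹ * W'.gen (Fin.last m) with hs
  have hs2' : s ^ 2 = (covering W').quartic a := by
    rw [hs, mul_pow, he, map_pow, inv_pow, inv_mul_cancel_left₀ (pow_ne_zero 2 hc0)]
  have hs2 : s ^ 2 = p.pullback ((covering W).quartic a) := hs2'.trans hquartic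
  have hgen : letI := p.toAlgebra
      IntermediateField.adjoin (abelianCover W).Fun {s} = ⊤ := by
    let := p.toAlgebra
    have hpull : ∀ f, p.pullback f ∈ IntermediateField.adjoin (abelianCover W).Fun {s} :=
      fun f => IntermediateField.algebraMap_mem _ f
    have hconst : ∀ c, algebraMap ℂ (abelianCover W').Fun c ∈
        IntermediateField.adjoin (abelianCover W).Fun {s} := fun c => by
      rw [← p.pullback.commutes]
      exact hpull _
    refine top_le_iff.1 fun f _ => W'.mem_subfield
      (IntermediateField.adjoin (abelianCover W).Fun {s}).toSubfield (fun g => ?_) (fun i => ?_) f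
    · rw [← hcomp]
      exact hpull _
    · change W'.gen i ∈ IntermediateField.adjoin (abelianCover W).Fun {s}
      refine Fin.lastCases ?_ (fun i => ?_) i
      · have h : W'.gen (Fin.last m) = algebraMap ℂ (abelianCover W').Fun c * s := by
          rw [hs, mul_inv_cancel_left₀ hc0]
        rw [h]
        exact mul_mem (hconst c) (IntermediateField.mem_adjoin_simple_self _ s)
      · have h : W'.gen (Fin.castSucc i) ^ N' = p.pullback (W.gen i) ^ N' :=
          Subtype.ext (hpow i).symm
        obtain ⟨b, hb⟩ := exists_eq_algebraMap_mul_of_pow_eq hN' h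
        rw [hb]
        exact mul_mem (hconst b) (hpull _)
  have hflat : p.pullbackQuad (flatStructure W) = flatStructure W' :=
    (covering W).pullbackQuad_comp_pillowcase a p
  refine ⟨p, hcomp, hflat, ⟨?_, fun Z r hr => ?_⟩, fun h => ?_, fun h => ?_⟩
  · rw [hflat]
    exact ((covering W').isSquareOfAbelian_iff ha).2 ⟨s, hs2'⟩
  · rw [flatStructure, Cover.pullbackQuad_comp_pillowcase, Cover.isSquareOfAbelian_iff _ ha,
      Cover.quartic_comp] at hr
    obtain ⟨t, ht⟩ := hr
    exact Cover.exists_comp_eq_of_sq hs2 hgen r ht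
  · obtain ⟨f, hf⟩ := ((covering W).isSquareOfAbelian_iff ha).1 h
    exact Cover.degree_eq_one_of_sq hs2 hgen hf
  · exact Cover.degree_eq_two_of_not_sq hs2 hgen
      fun hf => h (((covering W).isSquareOfAbelian_iff ha).2 hf)

end

end FlatCover

end

theorem mainTheorem6 (z : Fin 4 → ℂ) (hz : Function.Injective z) (N m : ℕ) (hN : 0 < N)
    (A : Matrix (Fin m) (Fin 4) (ZMod N)) (hA : FlatCover.RowSumsZero A) :
    (Even N → FlatCover.HolonomyCoverIs z A
      (FlatCover.addConstRow A ((N / 2 : ℕ) : ZMod N))) ∧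
    (Odd N → FlatCover.HolonomyCoverIs z A
      (FlatCover.addConstRow (FlatCover.double A) ((N : ℕ) : ZMod (2 * N)))) := by
  have : NeZero N := ⟨hN.ne'⟩
  constructor
  · rintro ⟨k, hk⟩
    refine FlatCover.holonomyCoverIs_of_val hz (d := 1) (M := N / 2) hN.ne' (one_mul N).symm
      (by omega) hA (fun i j => ?_) (fun j => ?_)
    · simp [FlatCover.addConstRow]
    · simp only [FlatCover.addConstRow, Matrix.of_apply, Fin.snoc_last]
      exact ZMod.val_cast_of_lt (by omega)
  · intro _
    refine FlatCover.holonomyCoverIs_of_val hz (d := 2) (M := N) (by omega) rfl rfl hA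
      (fun i j => ?_) (fun j => ?_)
    · simp only [FlatCover.addConstRow, FlatCover.double, Matrix.of_apply, Fin.snoc_castSucc]
      -- Since the lift of `A i j` is below `N`, its double is below `2 * N` and is not reduced.
      exact ZMod.val_cast_of_lt (by have := ZMod.val_lt (A i j); omega)
    · simp only [FlatCover.addConstRow, Matrix.of_apply, Fin.snoc_last]
      exact ZMod.val_cast_of_lt (by omega)
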